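/- Let $N \ge 1$ be an odd integer and let $E$ be an elliptic curve, given by a Weierstrass equation with nonzero discriminant, over an algebraically closed field $F$ whose characteristic does not divide $N$. Let $E[N] = \{P \in E(F) : [N]P = \mathcal O\}$ be the group of $N$-torsion points, where $\mathcal O$ is the point at infinity. Then $E[N]$ has exactly $N^2$ elements, and they can be placed in the cells of an $N \times N$ grid, each element occurring in exactly one cell, in such a way that the sum (in the group $E(F)$) of the entries of each row and of each column is $\mathcal O$. -/

import Mathlib

/-! Write x(nP) = f(x)/g(x). The symmetric functions of x(P+Q), x(P-Q) are quadratic in those of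
x(P), x(Q) (`exists_addSubMap_sym2x`), so the pair for n+2 comes from those for n and n+1
(`IsXMul.step`). The recursion shows that f is monic of degree n² and that X * g has coefficient n²
in that degree; hence the Wronskian of f, g is nonzero when n ≠ 0 in F. So for suitable x, f - x g
has n² distinct roots, and each lifts to exactly one point of the fibre of [n] over a point Q ≠ -Q
with abscissa x. That fibre is a coset of E[n] (`card_torsionBy`).

For the grid, take a subgroup H of order N and put t_i + h_j in cell (i, j), where the t_i represent
the cosets of H. Since N kills E[N], the line sums reduce to ∑ h_j and ∑ t_i. The first vanishes
because |H| is odd; the second is arranged by adjusting one t_i. -/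

namespace WeierstrassCurve.Affine.Point

open Polynomial

/-! ### Sum and difference on x-coordinates -/

section AddSub

variable {F : Type*} [Field F] [DecidableEq F] (W : WeierstrassCurve F)

/-- The addition-and-subtraction map on the symmetric square of the `x`-line, evaluated. -/
lemma eval_addSubMap {R : Type*} [CommRing R] (W : WeierstrassCurve R) (v : Fin 3 → R) :
    (fun i ↦ (addSubMap W i).eval v) =
      ![v 0 ^ 2 - W.b₄ * v 0 * v 2 - W.b₆ * v 1 * v 2 - W.b₈ * v 2 ^ 2,
        2 * v 1 * v 0 + W.b₂ * v 0 * v 2 + W.b₄ * v 1 * v 2 + W.b₆ * v 2 ^ 2,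
        v 1 ^ 2 - 4 * v 0 * v 2] := by
  ext i
  fin_cases i <;> simp [addSubMap]

lemma eval_addSubMap_smul {R : Type*} [CommRing R] (W : WeierstrassCurve R) (k : R)
    (v : Fin 3 → R) (i : Fin 3) :
    (addSubMap W i).eval (k • v) = k ^ 2 * (addSubMap W i).eval v := by
  rw [show (addSubMap W i).eval (k • v) = _ from congrFun (eval_addSubMap W (k • v)) i,
    show (addSubMap W i).eval v = _ from congrFun (eval_addSubMap W v) i]
  fin_cases i <;> simp <;> ring

lemma exists_addSubMap_some_some {x₁ y₁ x₂ y₂ : F} (h₁ : W.toAffine.Nonsingular x₁ y₁)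
    (h₂ : W.toAffine.Nonsingular x₂ y₂) (hx : x₁ ≠ x₂) :
    ∃ c : F, (fun i ↦ (addSubMap W i).eval ((some x₁ y₁ h₁).sym2x (some x₂ y₂ h₂))) =
      c • (some x₁ y₁ h₁ + some x₂ y₂ h₂).sym2x (some x₁ y₁ h₁ - some x₂ y₂ h₂) := by
  have e₁ := (W.toAffine.equation_iff x₁ y₁).mp h₁.1
  have e₂ := (W.toAffine.equation_iff x₂ y₂).mp h₂.1
  have hd : x₁ - x₂ ≠ 0 := sub_ne_zero.mpr hx
  refine ⟨(x₁ - x₂) ^ 2, ?_⟩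
  rw [eval_addSubMap, sub_eq_add_neg (some x₁ y₁ h₁), neg_some, add_of_X_ne hx, add_of_X_ne hx, sym2x_some_some,
    sym2x_some_some, slope_of_X_ne hx, slope_of_X_ne hx]
  -- The difference of the two curve equations evaluates the product of the slopes for P + Q and P -
  -- Q as k / d, cancelling the surplus denominators in the product of the abscissas.
  have hk : (y₁ - y₂) * (y₁ + y₂ + W.a₁ * x₂ + W.a₃) = (x₁ - x₂) *
      (x₁ ^ 2 + x₁ * x₂ + x₂ ^ 2 + W.a₂ * (x₁ + x₂) + W.a₄ - W.a₁ * y₁) := by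
    linear_combination e₁ - e₂
  have hprod : ∀ a s d e e' k : F, d ≠ 0 → e * e' = d * k →
      d ^ 2 * (((e / d) ^ 2 + a * (e / d) - s) * ((e' / d) ^ 2 + a * (e' / d) - s)) =
        k ^ 2 + a * k * (e + e') - s * ((e + e') ^ 2 - 2 * d * k) + a ^ 2 * d * k -
          a * s * d * (e + e') + s ^ 2 * d ^ 2 := by
    intro a s d e e' k hd h
    field_simp
    linear_combination (e * e' + d * k + a * d * (e + e') + 2 * s * d ^ 2 + a ^ 2 * d ^ 2) * h
  have hp := hprod W.a₁ (W.a₂ + x₁ + x₂) _ _ _ _ hd hk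
  have hA : ∀ l, W.toAffine.addX x₁ x₂ l = l ^ 2 + W.a₁ * l - (W.a₂ + x₁ + x₂) := by
    intro l; simp only [addX]; ring
  have hn : y₁ - W.toAffine.negY x₂ y₂ = y₁ + y₂ + W.a₁ * x₂ + W.a₃ := by
    simp only [negY]; ring
  rw [hn]
  ext i
  fin_cases i
  · simp only [Fin.zero_eta, Matrix.cons_val, Pi.smul_apply, smul_eq_mul, hA, hp, b₄, b₆, b₈]
    linear_combination (W.a₁ ^ 2 + 4 * (W.a₂ + x₁ + x₂)) * e₁
  · simp only [Fin.mk_one, Matrix.cons_val, Pi.smul_apply, smul_eq_mul, hA, b₂, b₄, b₆]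
    field_simp
    linear_combination (-2) * e₁ - 2 * e₂
  · simp only [Fin.reduceFinMk, Matrix.cons_val, Pi.smul_apply, smul_eq_mul]
    ring

lemma exists_addSubMap_self (P : W.toAffine.Point) :
    ∃ c : F, (fun i ↦ (addSubMap W i).eval (P.sym2x P)) = c • (P + P).sym2x (P - P) := by
  match P with
  | 0 => exact ⟨1, by rw [eval_addSubMap]; ext i; fin_cases i <;> simp⟩
  | some x y h =>
    have e := (W.toAffine.equation_iff x y).mp h.1
    by_cases hy : y = W.toAffine.negY x y
    · have hy' : 2 * y + W.a₁ * x + W.a₃ = 0 := by simp only [negY] at hy; linear_combination hy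
      -- Here 2P = 0, so the target is (1, 0, 0) and the scalar is the first coordinate of the map.
      refine ⟨(x * x) ^ 2 - W.b₄ * (x * x) - W.b₆ * (x + x) - W.b₈, ?_⟩
      rw [eval_addSubMap, add_self_of_Y_eq hy, sub_self, sym2x_zero_zero, sym2x_some_some]
      ext i
      fin_cases i
      · simp
      · simp [b₂, b₄, b₆]
        linear_combination (-4) * e + (2 * y + W.a₁ * x + W.a₃) * hy'
      · simp; ring
    · have hy' : y - W.toAffine.negY x y ≠ 0 := sub_ne_zero.mpr hy
      refine ⟨(y - W.toAffine.negY x y) ^ 2, ?_⟩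
      rw [eval_addSubMap, add_self_of_Y_ne hy, sub_self, sym2x_some_zero, sym2x_some_some,
        slope_of_Y_ne rfl hy]
      have hn : y - W.toAffine.negY x y = 2 * y + W.a₁ * x + W.a₃ := by simp only [negY]; ring
      rw [hn] at hy' ⊢
      have hA : ∀ m n : F, m ≠ 0 → m ^ 2 * W.toAffine.addX x x (n / m) =
          n ^ 2 + W.a₁ * n * m - (W.a₂ + 2 * x) * m ^ 2 := by
        intro m n hm
        simp only [addX]
        field_simp
        ring
      ext i
      fin_cases i
      · simp only [Fin.zero_eta, Matrix.cons_val, Pi.smul_apply, smul_eq_mul, hA _ _ hy', b₄, b₆, b₈]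
        linear_combination (W.a₁ ^ 2 + 4 * W.a₂ + 8 * x) * e
      · simp [b₂, b₄, b₆]
        linear_combination (-4) * e
      · simp; ring

/-- The map `addSubMap` sends `{x(P), x(Q)}` to `{x(P + Q), x(P - Q)}`. -/
theorem exists_addSubMap_sym2x [W.IsElliptic] (P Q : W.toAffine.Point) :
    ∃ c : F, c ≠ 0 ∧
      (fun i ↦ (addSubMap W i).eval (P.sym2x Q)) = c • (P + Q).sym2x (P - Q) := by
  suffices ∃ c : F, (fun i ↦ (addSubMap W i).eval (P.sym2x Q)) = c • (P + Q).sym2x (P - Q) by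
    obtain ⟨c, hc⟩ := this
    refine ⟨c, ?_, hc⟩
    rintro rfl
    exact addSubMap_ne_zero W (sym2x_ne_zero P Q) (by rw [hc, zero_smul])
  match P, Q with
  | 0, Q =>
    refine ⟨1, ?_⟩
    rw [eval_addSubMap, zero_add, zero_sub, sym2x_neg_right, one_smul]
    match Q with
    | 0 => ext i; fin_cases i <;> simp
    | some x y h => ext i; fin_cases i <;> simp <;> ring
  | some x y h, 0 =>
    refine ⟨1, ?_⟩
    rw [eval_addSubMap, add_zero, sub_zero, one_smul]
    ext i; fin_cases i <;> simp <;> ring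
  | some x₁ y₁ h₁, some x₂ y₂ h₂ =>
    by_cases hx : x₁ = x₂
    · rcases X_eq_iff.mp hx with h | h <;> rw [h]
      · exact exists_addSubMap_self W _
      · obtain ⟨c, hc⟩ := exists_addSubMap_self W (some x₂ y₂ h₂)
        refine ⟨c, ?_⟩
        rw [sym2x_neg_left, hc, ← sym2x_neg_left, sym2x_comm]
        congr 2 <;> abel
    · exact exists_addSubMap_some_some W h₁ h₂ hx

end AddSub

end WeierstrassCurve.Affine.Point

namespace WeierstrassCurve.Affine.Point

open Polynomial

/-! ### Splitting off a known factor of a binary form -/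

section XMul

/-- A binary quadratic form vanishing at the coprime pair (f : g) is (gU - fV)(g'U - f'V). -/
lemma factor_of_binary_form_eq_zero {R : Type*} [CommRing R] [IsDomain R] {f g T₀ T₁ T₂ : R}
    (hfg : IsCoprime f g) (hf : f ≠ 0) (h : T₀ * f ^ 2 - T₁ * f * g + T₂ * g ^ 2 = 0) :
    ∃ f' g', T₂ = f * f' ∧ T₁ = f * g' + f' * g ∧ T₀ = g * g' := by
  by_cases hg : g = 0
  · subst hg
    obtain ⟨u, hu⟩ := isCoprime_zero_right.mp hfg
    have hT : T₀ = 0 := by simpa [hf] using h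
    refine ⟨↑u⁻¹ * T₂, ↑u⁻¹ * T₁, ?_, ?_, ?_⟩ <;> simp [← hu, hT]
  · obtain ⟨g', rfl⟩ : g ∣ T₀ :=
      (hfg.symm.pow_right (n := 2)).dvd_of_dvd_mul_right
        ⟨T₁ * f - T₂ * g, by linear_combination h⟩
    obtain ⟨f', rfl⟩ : f ∣ T₂ :=
      (hfg.pow_right (n := 2)).dvd_of_dvd_mul_right
        ⟨T₁ * g - g * g' * f, by linear_combination h⟩
    refine ⟨f', g', rfl, ?_, rfl⟩
    apply mul_left_cancel₀ (mul_ne_zero hf hg)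
    linear_combination -h

variable {F : Type*} [Field F] {W : WeierstrassCurve F}

/-- `p` and `q` are homogeneous coordinates of the `x`-coordinate of `P`. -/
def IsXRep (P : W.toAffine.Point) (p q : F) : Prop :=
  ∃ c : F, c ≠ 0 ∧ p = c * P.xRep 0 ∧ q = c * P.xRep 1

lemma IsXRep.ne_zero_or {P : W.toAffine.Point} {p q : F} (h : IsXRep P p q) : p ≠ 0 ∨ q ≠ 0 := by
  obtain ⟨c, hc, rfl, rfl⟩ := h
  match P with
  | 0 => simp [hc]
  | some x y _ => simp [hc]

lemma IsXRep.sym2x {P Q : W.toAffine.Point} {p q p' q' : F} (h : IsXRep P p q)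
    (h' : IsXRep Q p' q') :
    ∃ c : F, c ≠ 0 ∧ ![p * p', p * q' + q * p', q * q'] = c • P.sym2x Q := by
  obtain ⟨c, hc, rfl, rfl⟩ := h
  obtain ⟨c', hc', rfl, rfl⟩ := h'
  refine ⟨c * c', mul_ne_zero hc hc', ?_⟩
  ext i
  fin_cases i <;> simp [Point.sym2x] <;> ring

lemma IsXRep.addSubMap [DecidableEq F] [W.IsElliptic] {P Q : W.toAffine.Point} {p q p' q' : F} (h : IsXRep P p q)
    (h' : IsXRep Q p' q') :
    ∃ c : F, c ≠ 0 ∧ (fun i ↦ (W.addSubMap i).eval ![p * p', p * q' + q * p', q * q']) =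
      c • (P + Q).sym2x (P - Q) := by
  obtain ⟨c, hc, he⟩ := h.sym2x h'
  obtain ⟨d, hd, hd'⟩ := exists_addSubMap_sym2x W P Q
  refine ⟨c ^ 2 * d, mul_ne_zero (pow_ne_zero 2 hc) hd, ?_⟩
  rw [he, mul_smul, ← hd']
  ext i
  simp [eval_addSubMap_smul]

lemma IsXRep.binary_form_eq_zero {P Q : W.toAffine.Point} {p q c : F} (h : IsXRep Q p q)
    {T : Fin 3 → F} (hT : T = c • P.sym2x Q) :
    T 2 * p ^ 2 - T 1 * p * q + T 0 * q ^ 2 = 0 := by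
  obtain ⟨d, -, rfl, rfl⟩ := h
  simp [hT, Point.sym2x]
  ring

/-- The symmetric functions of two points of the projective line, together with one of the points,
determine the other. -/
lemma IsXRep.of_factor {P Q : W.toAffine.Point} {p q p' q' c : F} (hc : c ≠ 0)
    (h : IsXRep Q p q) {T : Fin 3 → F} (hT : T = c • P.sym2x Q) (h₀ : T 0 = p * p')
    (h₁ : T 1 = p * q' + p' * q) (h₂ : T 2 = q * q') : IsXRep P p' q' := by
  obtain ⟨d, hd, rfl, rfl⟩ := h
  subst hT
  simp only [Point.sym2x, Pi.smul_apply, Matrix.cons_val, smul_eq_mul] at h₀ h₁ h₂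
  set X₀ := P.xRep 0
  set X₁ := P.xRep 1
  have hY : Q.xRep 0 ≠ 0 ∨ Q.xRep 1 ≠ 0 := by
    by_contra! hY
    exact Q.xRep_ne_zero (by ext i; fin_cases i <;> simp [hY])
  set Y₀ := Q.xRep 0
  set Y₁ := Q.xRep 1
  have key : d * p' = c * X₀ ∧ d * q' = c * X₁ := by
    rw [← sub_eq_zero, ← sub_eq_zero (a := d * q')]
    rcases hY with hY | hY
    · have h1 : d * p' - c * X₀ = 0 := by
        apply mul_left_cancel₀ hY; linear_combination -h₀
      refine ⟨h1, ?_⟩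
      apply mul_left_cancel₀ hY; linear_combination -h₁ - Y₁ * h1
    · have h1 : d * q' - c * X₁ = 0 := by
        apply mul_left_cancel₀ hY; linear_combination -h₂
      refine ⟨?_, h1⟩
      apply mul_left_cancel₀ hY; linear_combination -h₁ - Y₀ * h1
  refine ⟨c / d, div_ne_zero hc hd, ?_, ?_⟩ <;> field_simp
  exacts [by rw [mul_comm, key.1], by rw [mul_comm, key.2]]

end XMul

/-! ### Degrees and leading coefficients -/

section Degrees

variable {R : Type*} [CommRing R]

/-- The shape of the numerator and denominator of multiplication by an integer with square `m`
on `x`-coordinates. -/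
structure IsXMulShape (m : ℕ) (f g : R[X]) : Prop where
  monic : f.Monic
  natDegree : f.natDegree = m
  natDegree_le : (X * g).natDegree ≤ m
  coeff_eq : (X * g).coeff m = (m : R)

lemma IsXMulShape.natDegree_le' {m : ℕ} {f g : R[X]} (h : IsXMulShape m f g) :
    g.natDegree ≤ m := by
  rw [natDegree_le_iff_coeff_eq_zero]
  intro k hk
  rw [← coeff_X_mul]
  exact coeff_eq_zero_of_natDegree_lt (h.natDegree_le.trans_lt (by omega))

/-- The recursion for the shape of the multiplication maps on `x`-coordinates. -/
lemma IsXMulShape.step [IsDomain R] {m₀ m m₂ : ℕ} (hm : m₀ + m₂ = 2 * m + 2) (b₂ b₄ b₆ b₈ : R)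
    {f₀ g₀ f g f₂ g₂ : R[X]} (h₀ : IsXMulShape m₀ f₀ g₀) (h : IsXMulShape m f g)
    (hT₀ : (f * X) ^ 2 - C b₄ * (f * X) * g - C b₆ * (f + X * g) * g - C b₈ * g ^ 2 = f₀ * f₂)
    (hT₁ : 2 * (f + X * g) * (f * X) + C b₂ * (f * X) * g + C b₄ * (f + X * g) * g + C b₆ * g ^ 2 =
      f₀ * g₂ + f₂ * g₀) : IsXMulShape m₂ f₂ g₂ := by
  have hg := h.natDegree_le'
  have hG := h.natDegree_le
  have hf := h.natDegree.le
  have hfG : (f + X * g).natDegree ≤ m := natDegree_add_le_of_degree_le hf hG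
  have hCb (b : R) {p : R[X]} {k : ℕ} (hp : p.natDegree ≤ k) : (C b * p).natDegree ≤ k :=
    (natDegree_C_mul_le b p).trans hp
  have hfX : ((f * X) ^ 2).Monic := (h.monic.mul monic_X).pow 2
  have hfXd : ((f * X) ^ 2).natDegree = 2 * m + 2 := by
    rw [(h.monic.mul monic_X).natDegree_pow, natDegree_mul_X h.monic.ne_zero, h.natDegree]
    ring
  set r : R[X] := C b₄ * (f * (X * g)) + C b₆ * ((f + X * g) * g) + C b₈ * (g * g) with hr
  have hR : r.natDegree < ((f * X) ^ 2).natDegree := by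
    rw [hfXd]
    refine Nat.lt_of_le_of_lt (m := m + m) ?_ (by omega)
    exact natDegree_add_le_of_degree_le (natDegree_add_le_of_degree_le
      (hCb _ (natDegree_mul_le_of_le hf hG)) (hCb _ (natDegree_mul_le_of_le hfG hg)))
      (hCb _ (natDegree_mul_le_of_le hg hg))
  have hT : (f * X) ^ 2 - r = f₀ * f₂ := by rw [← hT₀, hr]; ring
  have hmon : (f₀ * f₂).Monic := hT ▸ hfX.sub_of_left (degree_lt_degree hR)
  have hf₂ : f₂.Monic := h₀.monic.of_mul_monic_left hmon
  have hf₂d : f₂.natDegree = m₂ := by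
    have := h₀.monic.natDegree_mul hf₂
    rw [← hT, natDegree_sub_eq_left_of_natDegree_lt hR, hfXd, h₀.natDegree] at this
    omega
  set t : R[X] := X * (C b₂ * (f * (X * g))) + C b₄ * ((f + X * g) * (X * g)) +
    C b₆ * (g * (X * g)) with ht
  have htd : t.natDegree ≤ 2 * m + 1 := by
    have h1 : (X * (C b₂ * (f * (X * g)))).natDegree ≤ 1 + (m + m) :=
      natDegree_mul_le_of_le natDegree_X_le (hCb _ (natDegree_mul_le_of_le hf hG))
    refine (natDegree_add_le_of_degree_le (natDegree_add_le_of_degree_le h1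
      ((hCb _ (natDegree_mul_le_of_le hfG hG)).trans (by omega)))
      ((hCb _ (natDegree_mul_le_of_le hg hG)).trans (by omega))).trans (by omega)
  have hsd : (C 2 * (f * (f + X * g))).natDegree ≤ 2 * m :=
    (hCb _ (natDegree_mul_le_of_le hf hfG)).trans (by omega)
  -- Comparing coefficients in degree m₀ + m₂ = 2m + 2 gives 2(1 + m) - m₀ = m₂ for X * g₂.
  have hT' : f₀ * (X * g₂) = X ^ 2 * (C 2 * (f * (f + X * g))) + t - f₂ * (X * g₀) := by
    rw [ht, C_ofNat]
    linear_combination (-X) * hT₁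
  have hd : (f₀ * (X * g₂)).natDegree ≤ 2 * m + 2 := by
    rw [hT']
    have h1 : (X ^ 2 * (C 2 * (f * (f + X * g)))).natDegree ≤ 2 + 2 * m :=
      natDegree_mul_le_of_le (natDegree_X_pow_le 2) hsd
    have h2 : (f₂ * (X * g₀)).natDegree ≤ m₂ + m₀ :=
      natDegree_mul_le_of_le hf₂d.le h₀.natDegree_le
    have h3 := natDegree_add_le_of_degree_le (h1.trans (by omega : _ ≤ 2 * m + 2))
      (htd.trans (by omega : _ ≤ 2 * m + 2))
    exact (natDegree_sub_le_of_le h3 h2).trans (by omega)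
  have hg₂d : (X * g₂).natDegree ≤ m₂ := by
    by_cases hg₂ : X * g₂ = 0
    · simp [hg₂]
    · rw [h₀.monic.natDegree_mul' hg₂, h₀.natDegree] at hd
      omega
  refine ⟨hf₂, hf₂d, hg₂d, ?_⟩
  have hone {k : ℕ} {p : R[X]} (hp : p.Monic) (hk : p.natDegree = k) : p.coeff k = 1 := by
    rw [← hk]; exact hp
  have e1 : (f₀ * (X * g₂)).coeff (m₀ + m₂) = (X * g₂).coeff m₂ := by
    rw [coeff_mul_add_eq_of_natDegree_le h₀.natDegree.le hg₂d, hone h₀.monic h₀.natDegree, one_mul]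
  have e2 : (f₂ * (X * g₀)).coeff (m₂ + m₀) = (m₀ : R) := by
    rw [coeff_mul_add_eq_of_natDegree_le hf₂d.le h₀.natDegree_le, hone hf₂ hf₂d, one_mul, h₀.coeff_eq]
  have e3 : (X ^ 2 * (C 2 * (f * (f + X * g)))).coeff (m₀ + m₂) = (2 * (1 + m) : R) := by
    rw [hm, coeff_X_pow_mul, coeff_C_mul, two_mul m, coeff_mul_add_eq_of_natDegree_le hf hfG, coeff_add,
      hone h.monic h.natDegree, h.coeff_eq, one_mul]
  have e4 : t.coeff (m₀ + m₂) = 0 := coeff_eq_zero_of_natDegree_lt (by omega)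
  rw [hT', coeff_sub, coeff_add, e3, e4, add_comm m₀, e2] at e1
  have hm' : (m₀ + m₂ : R) = 2 * m + 2 := by exact_mod_cast congrArg (Nat.cast (R := R)) hm
  linear_combination -e1 - hm'

/-- If `m` is nonzero, the map `f / g` has nonzero derivative. -/
lemma IsXMulShape.wronskian_ne_zero {m : ℕ} {f g : R[X]} (h : IsXMulShape m f g)
    (hm : (m : R) ≠ 0) : derivative f * g - f * derivative g ≠ 0 := by
  intro h0
  -- After this scaling the coefficient in degree 2m is m·m - m(m - 1) = m.
  have h1 : (X * derivative f) * (X * g) - f * (X * (X * derivative g)) = 0 := by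
    linear_combination X ^ 2 * h0
  have hXd {p : R[X]} (k : ℕ) : (X * derivative p).coeff k = p.coeff k * (k : R) := by
    cases k with
    | zero => simp
    | succ k => rw [coeff_X_mul, coeff_derivative]; push_cast; ring
  have hXXd {p : R[X]} (k : ℕ) : (X * (X * derivative p)).coeff k = (X * p).coeff k * ((k : R) - 1) := by
    cases k with
    | zero => simp
    | succ k => rw [coeff_X_mul, coeff_X_mul, hXd]; push_cast; ring
  have hd1 : (X * derivative f).natDegree ≤ m := by
    rw [natDegree_le_iff_coeff_eq_zero]
    intro k hk
    rw [hXd, coeff_eq_zero_of_natDegree_lt (h.natDegree ▸ hk), zero_mul]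
  have hd2 : (X * (X * derivative g)).natDegree ≤ m := by
    rw [natDegree_le_iff_coeff_eq_zero]
    intro k hk
    rw [hXXd, coeff_eq_zero_of_natDegree_lt (h.natDegree_le.trans_lt hk), zero_mul]
  have hone : f.coeff m = 1 := by
    have := h.monic.coeff_natDegree
    rwa [h.natDegree] at this
  have h2 := congrArg (coeff · (m + m)) h1
  simp only [coeff_sub, coeff_zero] at h2
  rw [coeff_mul_add_eq_of_natDegree_le hd1 h.natDegree_le,
    coeff_mul_add_eq_of_natDegree_le h.natDegree.le hd2, hXd, hXXd, hone, h.coeff_eq] at h2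
  exact hm (by linear_combination h2)

end Degrees

/-! ### Existence of the multiplication maps -/

section AlgClosed

variable {F : Type*} [Field F] [IsAlgClosed F] (W : WeierstrassCurve F) [W.IsElliptic]

lemma exists_nonsingular (a : F) : ∃ b, W.toAffine.Nonsingular a b := by
  obtain ⟨b, hb⟩ := IsAlgClosed.exists_root
    (X ^ 2 + C (W.a₁ * a + W.a₃) * X - C (a ^ 3 + W.a₂ * a ^ 2 + W.a₄ * a + W.a₆) : F[X]) (by
      have : (X ^ 2 + C (W.a₁ * a + W.a₃) * X - C (a ^ 3 + W.a₂ * a ^ 2 + W.a₄ * a + W.a₆)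
        : F[X]).degree = 2 := by compute_degree!
      rw [this]
      decide)
  refine ⟨b, (W.toAffine.equation_iff_nonsingular).mp ((W.toAffine.equation_iff _ _).mpr ?_)⟩
  simp only [IsRoot, eval_sub, eval_add, eval_pow, eval_X, eval_mul, eval_C] at hb
  linear_combination hb

variable [DecidableEq F]

/-- The fraction `f / g` expresses `x(n • P)` in terms of `x(P)`. -/
def IsXMul (n : ℕ) (f g : F[X]) : Prop :=
  IsXMulShape (n ^ 2) f g ∧ ∀ (a b : F) (h : W.toAffine.Nonsingular a b),
    IsXRep (n • some a b h) (f.eval a) (g.eval a)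

variable {W}

/-- A common root would be the abscissa of a point P with x(nP) = (0 : 0). -/
lemma IsXMul.isCoprime {n : ℕ} {f g : F[X]} (h : IsXMul W n f g) : IsCoprime f g := by
  refine isCoprime_of_irreducible_dvd (fun h0 ↦ h.1.monic.ne_zero h0.1) fun p hp hpf hpg ↦ ?_
  obtain ⟨a, ha⟩ := IsAlgClosed.exists_root p (degree_pos_of_irreducible hp).ne'
  obtain ⟨b, hb⟩ := exists_nonsingular W a
  rcases (h.2 a b hb).ne_zero_or with h0 | h0
  exacts [h0 (ha.dvd hpf), h0 (ha.dvd hpg)]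

theorem IsXMul.step {n : ℕ} {f₀ g₀ f g : F[X]} (h₀ : IsXMul W n f₀ g₀)
    (h : IsXMul W (n + 1) f g) : ∃ f₂ g₂, IsXMul W (n + 2) f₂ g₂ := by
  set T₀ : F[X] := (f * X) ^ 2 - C W.b₄ * (f * X) * g - C W.b₆ * (f + X * g) * g - C W.b₈ * g ^ 2
    with hT₀
  set T₁ : F[X] := 2 * (f + X * g) * (f * X) + C W.b₂ * (f * X) * g + C W.b₄ * (f + X * g) * g +
    C W.b₆ * g ^ 2 with hT₁
  set T₂ : F[X] := (f + X * g) ^ 2 - 4 * (f * X) * g with hT₂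
  have hT (a b : F) (hab : W.toAffine.Nonsingular a b) : ∃ c : F, c ≠ 0 ∧
      ![T₀.eval a, T₁.eval a, T₂.eval a] =
        c • ((n + 2) • some a b hab).sym2x (n • some a b hab) := by
    have hP : IsXRep (some a b hab) a 1 := ⟨1, one_ne_zero, by simp, by simp⟩
    obtain ⟨c, hc, he⟩ := (h.2 a b hab).addSubMap hP
    refine ⟨c, hc, ?_⟩
    rw [eval_addSubMap] at he
    rw [show (n + 2) • some a b hab = (n + 1) • some a b hab + some a b hab by module,
      show n • some a b hab = (n + 1) • some a b hab - some a b hab by module, ← he]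
    ext i
    fin_cases i <;> simp only [hT₀, hT₁, hT₂, eval_sub, eval_add, eval_mul, eval_pow, eval_C,
      eval_X, eval_ofNat, Fin.zero_eta, Fin.mk_one, Fin.reduceFinMk, Matrix.cons_val] <;> ring
  have hform : T₂ * f₀ ^ 2 - T₁ * f₀ * g₀ + T₀ * g₀ ^ 2 = 0 := by
    refine Polynomial.funext fun a ↦ ?_
    obtain ⟨b, hb⟩ := exists_nonsingular W a
    obtain ⟨c, hc, he⟩ := hT a b hb
    simpa using (h₀.2 a b hb).binary_form_eq_zero he
  obtain ⟨f₂, g₂, e₀, e₁, e₂⟩ :=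
    factor_of_binary_form_eq_zero h₀.isCoprime h₀.1.monic.ne_zero hform
  -- The degree condition is n² + (n + 2)² = 2(n + 1)² + 2.
  refine ⟨f₂, g₂, h₀.1.step (by ring) W.b₂ W.b₄ W.b₆ W.b₈ h.1 e₀ e₁, fun a b hb ↦ ?_⟩
  obtain ⟨c, hc, he⟩ := hT a b hb
  exact (h₀.2 a b hb).of_factor hc he (by simp [e₀]) (by simp [e₁]) (by simp [e₂])

variable (W) in
theorem exists_isXMul (n : ℕ) : ∃ f g : F[X], IsXMul W n f g := by
  suffices (∃ f g : F[X], IsXMul W n f g) ∧ ∃ f g : F[X], IsXMul W (n + 1) f g from this.1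
  induction n with
  | zero =>
    refine ⟨⟨1, 0, ⟨monic_one, by simp, by simp, by simp⟩, fun a b h ↦ ⟨1, one_ne_zero, ?_⟩⟩,
      X, 1, ⟨monic_X, by simp, by simp, by simp⟩, fun a b h ↦ ⟨1, one_ne_zero, ?_⟩⟩ <;> simp
  | succ n ih =>
    obtain ⟨⟨f₀, g₀, h₀⟩, f, g, h⟩ := ih
    exact ⟨⟨f, g, h⟩, h₀.step h⟩

end AlgClosed

end WeierstrassCurve.Affine.Point

/-! ### Grids in finite abelian groups -/

section MagicGrid

/-- A finite abelian group has a subgroup of every order dividing its cardinality. -/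
theorem AddCommGroup.exists_addSubgroup_card {A : Type*} [AddCommGroup A] [Finite A] {d : ℕ}
    (hd : d ∣ Nat.card A) : ∃ H : AddSubgroup A, Nat.card H = d := by
  induction d using Nat.recOnMul generalizing A with
  | zero => exact absurd (Nat.eq_zero_of_zero_dvd hd) Nat.card_pos.ne'
  | one => exact ⟨⊥, by simp⟩
  | prime p hp =>
    have : Fact p.Prime := ⟨hp⟩
    obtain ⟨x, hx⟩ := exists_prime_addOrderOf_dvd_card' p hd
    exact ⟨AddSubgroup.zmultiples x, by rw [Nat.card_zmultiples, hx]⟩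
  | mul a b iha ihb =>
    obtain ⟨H, hH⟩ := iha (dvd_of_mul_right_dvd hd)
    have hcard : Nat.card A = Nat.card (A ⧸ H) * a := by
      rw [H.card_eq_card_quotient_mul_card_addSubgroup, hH]
    have ha : 0 < a := hH ▸ Nat.card_pos
    obtain ⟨K, hK⟩ := ihb (A := A ⧸ H)
      (Nat.dvd_of_mul_dvd_mul_right ha (by rwa [← hcard, mul_comm]))
    refine ⟨K.comap (QuotientAddGroup.mk' H), ?_⟩
    have hi := K.index_comap_of_surjective (QuotientAddGroup.mk'_surjective H)
    have h1 := (K.comap (QuotientAddGroup.mk' H)).card_mul_index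
    have h2 := K.card_mul_index
    rw [hi, hcard, ← h2, hK, mul_right_comm, mul_comm b a] at h1
    exact Nat.eq_of_mul_eq_mul_right (Nat.pos_of_ne_zero K.index_ne_zero_of_finite) h1

/-- The elements of a finite abelian group without elements of order two sum to zero. -/
lemma sum_univ_eq_zero_of_odd_card {A : Type*} [AddCommGroup A] [Fintype A]
    (h : Odd (Nat.card A)) : ∑ a : A, a = 0 := by
  have h1 : ∑ a : A, a = -∑ a : A, a := by
    rw [← Finset.sum_neg_distrib]
    exact (Equiv.sum_comp (Equiv.neg A) (fun a ↦ a)).symm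
  have h2 : 2 • ∑ a : A, a = 0 := by
    rw [two_nsmul]; nth_rw 1 [h1]; exact neg_add_cancel _
  have h3 : addOrderOf (∑ a : A, a) ∣ 1 :=
    (Nat.coprime_two_left.mpr h) ▸ Nat.dvd_gcd (addOrderOf_dvd_of_nsmul_eq_zero h2)
      (addOrderOf_dvd_natCard _)
  exact AddMonoid.addOrderOf_eq_one_iff.mp (Nat.dvd_one.mp h3)

/-- An abelian group of odd order `N ^ 2` killed by `N` fills an `N × N` grid in which every row
and every column sums to zero. -/
theorem exists_grid_of_card_eq_sq {A : Type*} [AddCommGroup A] [Finite A] {N : ℕ} (hN : Odd N)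
    (hcard : Nat.card A = N ^ 2) (htors : ∀ a : A, N • a = 0) :
    ∃ M : Fin N → Fin N → A, Function.Bijective (fun c : Fin N × Fin N ↦ M c.1 c.2) ∧
      (∀ i, ∑ j, M i j = 0) ∧ (∀ j, ∑ i, M i j = 0) := by
  classical
  obtain ⟨H, hH⟩ := AddCommGroup.exists_addSubgroup_card (A := A) (d := N)
    (hcard ▸ Dvd.intro_left N (sq N).symm)
  have : Fintype A := Fintype.ofFinite A
  have : Fintype (A ⧸ H) := Fintype.ofFinite _
  have : Fintype H := Fintype.ofFinite _
  have hQ : Nat.card (A ⧸ H) = N := by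
    have := H.card_eq_card_quotient_mul_card_addSubgroup
    rw [hcard, hH, sq] at this
    exact (Nat.eq_of_mul_eq_mul_right hN.pos this).symm
  let q : Fin N ≃ A ⧸ H := (Finite.equivFinOfCardEq hQ).symm
  let h : Fin N ≃ H := (Finite.equivFinOfCardEq hH).symm
  have hsH : ∑ j, (h j : A) = 0 := by
    rw [Equiv.sum_comp h (fun x : H ↦ (x : A)), ← AddSubgroup.val_finsetSum,
      sum_univ_eq_zero_of_odd_card (hH ▸ hN), ZeroMemClass.coe_zero]
  have hsQ : ∑ i, ((q i).out : A) ∈ H := by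
    rw [← QuotientAddGroup.eq_zero_iff, ← QuotientAddGroup.mk'_apply, map_sum]
    simp only [QuotientAddGroup.mk'_apply, QuotientAddGroup.out_eq']
    rw [Equiv.sum_comp q (fun x ↦ x), sum_univ_eq_zero_of_odd_card (hQ ▸ hN)]
  let i₀ : Fin N := ⟨0, hN.pos⟩
  -- The representatives sum to an element of H, so subtracting that sum from one of them keeps its
  -- coset and makes the total zero.
  let t : Fin N → A := fun i ↦ (q i).out - if i = i₀ then ∑ i, (q i).out else 0
  have ht : ∑ i, t i = 0 := by simp [t]
  have htq (i : Fin N) : (t i : A ⧸ H) = q i := by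
    have : (if i = i₀ then ∑ i, (q i).out else 0) ∈ H := by
      split_ifs
      exacts [hsQ, H.zero_mem]
    simp only [t, QuotientAddGroup.mk_sub, QuotientAddGroup.out_eq',
      (QuotientAddGroup.eq_zero_iff _).mpr this, sub_zero]
  refine ⟨fun i j ↦ t i + h j, (Nat.bijective_iff_injective_and_card _).mpr ⟨?_, ?_⟩, ?_, ?_⟩
  · rintro ⟨i, j⟩ ⟨i', j'⟩ hij
    simp only at hij
    have hi : i = i' := by
      apply q.injective
      rw [← htq, ← htq]
      simpa using congrArg (QuotientAddGroup.mk (s := H)) hij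
    subst hi
    rw [add_right_inj, Subtype.coe_inj, h.injective.eq_iff] at hij
    rw [hij]
  · rw [hcard, Nat.card_prod, Nat.card_fin, sq]
  · intro i
    simp [Finset.sum_add_distrib, hsH, htors]
  · intro j
    simp [Finset.sum_add_distrib, ht, htors]

end MagicGrid

namespace WeierstrassCurve.Affine.Point

open Polynomial

/-! ### Counting torsion -/

section TorsionCard

variable {F : Type*} [Field F] [DecidableEq F] {W : WeierstrassCurve F}

lemma IsXMul.smul_eq_zero_iff {n : ℕ} {f g : F[X]} (h : IsXMul W n f g) {a b : F}
    (hab : W.toAffine.Nonsingular a b) : n • some a b hab = 0 ↔ g.eval a = 0 := by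
  obtain ⟨c, hc, -, h2⟩ := h.2 a b hab
  rw [h2]
  match n • some a b hab with
  | 0 => simp
  | some x y _ => simp [hc]

lemma IsXMul.eval_eq {n : ℕ} {f g : F[X]} (h : IsXMul W n f g) {a b : F}
    (hab : W.toAffine.Nonsingular a b) {x y : F} {hxy : W.toAffine.Nonsingular x y}
    (he : n • some a b hab = some x y hxy) : f.eval a = x * g.eval a := by
  obtain ⟨c, -, h1, h2⟩ := h.2 a b hab
  rw [h1, h2, he]
  simp [mul_comm]

lemma IsXMul.smul_eq_or_eq_neg {n : ℕ} {f g : F[X]} (h : IsXMul W n f g) {a b : F}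
    (hab : W.toAffine.Nonsingular a b) {x y : F} (hxy : W.toAffine.Nonsingular x y)
    (he : f.eval a = x * g.eval a) :
    n • some a b hab = some x y hxy ∨ n • some a b hab = -some x y hxy := by
  obtain ⟨c, hc, h1, h2⟩ := h.2 a b hab
  apply eq_or_eq_neg_of_xRep_eq_xRep
  rw [h1, h2] at he
  generalize n • some a b hab = P at *
  match P with
  | 0 => simp [hc] at he
  | some x' y' _ =>
    simp only [xRep_some, Matrix.cons_val] at he ⊢
    rw [mul_left_cancel₀ hc (he.trans (by ring : _ = c * x))]

variable [IsAlgClosed F] [W.IsElliptic]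

lemma IsXMul.denom_ne_zero {n : ℕ} {f g : F[X]} (h : IsXMul W n f g) (hn : n ≠ 0) : g ≠ 0 := by
  rintro rfl
  have h1 := h.1.monic.isUnit_iff.mp (isCoprime_zero_right.mp h.isCoprime)
  have h2 := h.1.natDegree
  rw [h1, natDegree_one] at h2
  exact pow_ne_zero 2 hn h2.symm

/-- Away from finitely many `x`, the equation `f = x * g` has as many solutions as its degree. -/
lemma IsXMul.exists_card_roots {n : ℕ} {f g : F[X]} (h : IsXMul W n f g) (hn : (n : F) ≠ 0)
    {r : F[X]} (hr : r ≠ 0) :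
    ∃ x : F, r.eval x ≠ 0 ∧ (f - C x * g).roots.toFinset.card = n ^ 2 := by
  have hw := h.1.wronskian_ne_zero (by exact_mod_cast pow_ne_zero 2 hn)
  -- Avoid the roots of r and the values of f / g at zeros of the Wronskian; a multiple root of f -
  -- x g would make x such a value.
  obtain ⟨x, hx⟩ := Infinite.exists_notMem_finset
    (r.roots.toFinset ∪ (derivative f * g - f * derivative g).roots.toFinset.image
      fun a ↦ f.eval a / g.eval a)
  simp only [Finset.mem_union, Multiset.mem_toFinset, mem_roots hr, IsRoot.def, Finset.mem_image,
    mem_roots hw, not_or, not_exists, not_and] at hx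
  refine ⟨x, hx.1, ?_⟩
  have hn0 : 0 < n ^ 2 := by
    refine pow_pos (Nat.pos_of_ne_zero ?_) 2
    rintro rfl
    simp at hn
  have hdeg : (C x * g).natDegree < f.natDegree := by
    rw [h.1.natDegree]
    refine (natDegree_C_mul_le _ _).trans_lt ?_
    have hg := h.denom_ne_zero (by rintro rfl; simp at hn)
    have := h.1.natDegree_le
    rw [natDegree_X_mul hg] at this
    omega
  have hsep : (f - C x * g).Separable := by
    refine isCoprime_of_irreducible_dvd (fun h0 ↦ ?_) fun p hp hpf hpd ↦ ?_
    · rw [sub_eq_zero.mp h0.1] at hdeg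
      exact hdeg.false
    · obtain ⟨a, ha⟩ := IsAlgClosed.exists_root p (degree_pos_of_irreducible hp).ne'
      have h1 : f.eval a - x * g.eval a = 0 := by simpa using ha.dvd hpf
      have h2 : (derivative f).eval a - x * (derivative g).eval a = 0 := by simpa using ha.dvd hpd
      obtain ⟨b, hb⟩ := exists_nonsingular W a
      have hga : g.eval a ≠ 0 := by
        intro h0
        rcases (h.2 a b hb).ne_zero_or with h3 | h3
        · rw [h0, mul_zero, sub_zero] at h1
          exact h3 h1
        · exact h3 h0
      refine hx.2 a ?_ ?_
      · simp only [eval_sub, eval_mul]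
        linear_combination g.eval a * h2 - (derivative g).eval a * h1
      · rw [div_eq_iff hga]
        linear_combination h1
  rw [Multiset.toFinset_card_of_nodup (nodup_roots hsep),
    ← (IsAlgClosed.splits (f - C x * g)).natDegree_eq_card_roots,
    natDegree_sub_eq_left_of_natDegree_lt hdeg, h.1.natDegree]

variable (W) in
/-- The `n`-torsion of an elliptic curve over an algebraically closed field in which `n` is
nonzero has `n ^ 2` elements. -/
theorem card_torsionBy {n : ℕ} (hn : (n : F) ≠ 0) :
    Nat.card (AddSubgroup.torsionBy W.toAffine.Point (n : ℤ)) = n ^ 2 := by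
  obtain ⟨f, g, h⟩ := exists_isXMul W n
  obtain ⟨f₂, g₂, h₂⟩ := exists_isXMul W 2
  -- Taking r to be the denominator of doubling ensures 2Q ≠ 0.
  obtain ⟨x, hx, hcard⟩ := h.exists_card_roots hn (h₂.denom_ne_zero two_ne_zero)
  obtain ⟨y, hxy⟩ := exists_nonsingular W x
  set Q := some x y hxy with hQ
  have hQ2 : Q ≠ -Q := fun h0 ↦ hx <| (h₂.smul_eq_zero_iff hxy).mp <| by
    rw [two_nsmul, ← hQ]; nth_rw 1 [h0]; exact neg_add_cancel Q
  have hf0 : f - C x * g ≠ 0 := by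
    intro h0
    rw [h0] at hcard
    have : n = 0 := by simpa using hcard.symm
    simp [this] at hn
  have hroot {a : F} : a ∈ (f - C x * g).roots.toFinset ↔ f.eval a = x * g.eval a := by
    simp [hf0, sub_eq_zero]
  have hlift (a : F) (ha : a ∈ (f - C x * g).roots.toFinset) :
      ∃ (b : F) (hab : W.toAffine.Nonsingular a b), n • some a b hab = Q := by
    obtain ⟨b, hb⟩ := exists_nonsingular W a
    rcases h.smul_eq_or_eq_neg hb hxy (hroot.mp ha) with h1 | h1
    · exact ⟨b, hb, h1⟩
    · refine ⟨W.toAffine.negY a b, (nonsingular_neg ..).mpr hb, ?_⟩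
      rw [← neg_some hb, smul_neg, h1, neg_neg]
  choose b hb hbQ using hlift
  let φ (a : (f - C x * g).roots.toFinset) : {P : W.toAffine.Point // n • P = Q} :=
    ⟨some a.1 (b a.1 a.2) (hb a.1 a.2), hbQ a.1 a.2⟩
  -- Two points over the same root are equal or opposite; opposite ones in the fibre would force Q =
  -- -Q.
  have hφ : Function.Bijective φ := by
    refine ⟨fun a a' haa ↦ ?_, fun ⟨P, hP⟩ ↦ ?_⟩
    · simp only [φ, Subtype.mk.injEq, some.injEq] at haa
      exact Subtype.ext haa.1
    · match P with
      | 0 => rw [smul_zero] at hP; exact absurd hP.symm (some_ne_zero hxy)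
      | some a c hac =>
        have ha := hroot.mpr (h.eval_eq hac hP)
        refine ⟨⟨a, ha⟩, Subtype.ext ?_⟩
        rcases (X_eq_iff (h₁ := hb a ha) (h₂ := hac)).mp rfl with h1 | h1
        · exact h1
        · refine absurd ?_ hQ2
          rw [← hP, ← smul_neg, ← h1, hbQ, hP]
  have hfib : Nat.card {P : W.toAffine.Point // n • P = Q} = n ^ 2 := by
    rw [← Nat.card_congr (Equiv.ofBijective φ hφ), Nat.card_eq_fintype_card, Fintype.card_coe,
      hcard]
  have : 0 < Nat.card {P : W.toAffine.Point // n • P = Q} := by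
    rw [hfib]
    exact pow_pos (Nat.pos_of_ne_zero (by rintro rfl; simp at hn)) 2
  obtain ⟨P₀, hP₀⟩ := (Nat.card_pos_iff.mp this).1.some
  rw [← hfib]
  exact Nat.card_congr <| (Equiv.addRight P₀).subtypeEquiv fun P ↦ by
    change (n : ℤ) • P = 0 ↔ _
    rw [natCast_zsmul, Equiv.coe_addRight, smul_add, hP₀,
      add_eq_right]

end TorsionCard

end WeierstrassCurve.Affine.Point

theorem mainTheorem1 {F : Type*} [Field F] [IsAlgClosed F] [DecidableEq F]
    (E : WeierstrassCurve F) [E.IsElliptic]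
    (N : ℕ) (hN : Odd N) (hchar : ¬ ringChar F ∣ N) :
    ∃ M : Fin N → Fin N → E.toAffine.Point,
      Set.BijOn (fun c : Fin N × Fin N => M c.1 c.2) Set.univ
        (AddSubgroup.torsionBy E.toAffine.Point (N : ℤ) : Set E.toAffine.Point) ∧
      (∀ i, ∑ j, M i j = 0) ∧
      (∀ j, ∑ i, M i j = 0) := by
  have hcard := WeierstrassCurve.Affine.Point.card_torsionBy E
    (fun h ↦ hchar ((ringChar.spec F N).mp h))
  have : Finite (AddSubgroup.torsionBy E.toAffine.Point (N : ℤ)) :=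
    Nat.finite_of_card_ne_zero (hcard ▸ pow_ne_zero 2 hN.pos.ne')
  obtain ⟨M, hM, hrow, hcol⟩ := exists_grid_of_card_eq_sq hN hcard fun P ↦
    Subtype.ext <| by simp
  refine ⟨fun i j ↦ M i j, ⟨fun c _ ↦ (M c.1 c.2).2, fun c _ c' _ h ↦
    hM.1 (Subtype.ext h), fun P hP ↦ ?_⟩, fun i ↦ ?_, fun j ↦ ?_⟩
  · obtain ⟨c, hc⟩ := hM.2 ⟨P, hP⟩
    exact ⟨c, Set.mem_univ c, congrArg Subtype.val hc⟩
  · rw [← AddSubgroup.val_finsetSum, hrow, ZeroMemClass.coe_zero]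
  · rw [← AddSubgroup.val_finsetSum, hcol, ZeroMemClass.coe_zero]
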